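/- Let $d\ge 1$ and let $f\in\mathbb{R}[x]$ be a polynomial of degree $d$ with $f(x)>0$ for all real $x\ge 0$. For complex $a,s$ with $d\,\Re(a)>\Re(s)>0$ put $$F_f(a,s)=\int_0^\infty f(x)^{-a}x^{s}\,\frac{dx}{x}.$$ The series $$\zeta_f(s)=\sum_{n,m\ge 1}\left(n\,m^{d+1}f\!\left(\tfrac nm\right)\right)^{-s}$$ converges absolutely for $\Re(s)>\frac{2}{d+2}$, and the function it defines on this half-plane has a meromorphic continuation to a connected open set that contains this half-plane and the point $s=\frac{2}{d+2}$. Every such continuation (in particular a meromorphic continuation to $\mathbb{C}$), again denoted $\zeta_f$, has a simple pole at $s=\frac{2}{d+2}$, with residue $$\frac{1}{d+2}F_f\!\left(\frac{2}{d+2},\frac{d}{d+2}\right)=\frac{1}{d+2}\int_0^\infty (xf(x))^{-2/(d+2)}\,dx,$$ where the last integral converges. -/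

import Mathlib

open Set Filter Topology MeasureTheory Polynomial

noncomputable section

namespace WittenZeta

/-- The positive real number `n m^(d+1) f(n/m)`, where `d = deg f` and `n, m ≥ 1`. -/
def base (f : ℝ[X]) (n m : ℕ+) : ℝ :=
  (n : ℝ) * (m : ℝ) ^ (f.natDegree + 1) * f.eval ((n : ℝ) / (m : ℝ))

/-- The general term `(n m^(d+1) f(n/m))^(-s)` of the double series. -/
def term (f : ℝ[X]) (s : ℂ) (p : ℕ+ × ℕ+) : ℂ :=
  ((base f p.1 p.2 : ℝ) : ℂ) ^ (-s)

/-- The double series `∑_{n,m ≥ 1} (n m^(d+1) f(n/m))^(-s)`. -/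
def series (f : ℝ[X]) (s : ℂ) : ℂ :=
  ∑' p : ℕ+ × ℕ+, term f s p

/-- The point `2/(d+2)`, where `d = deg f`. -/
def abscissa (f : ℝ[X]) : ℝ := 2 / ((f.natDegree : ℝ) + 2)

/-- The open half-plane `Re s > 2/(d+2)`. -/
def halfPlane (f : ℝ[X]) : Set ℂ := {s : ℂ | abscissa f < s.re}

/-- `Z` is a meromorphic continuation to the connected open set `U` of the function defined by the
series on the half-plane `Re s > 2/(d+2)`. -/
structure IsMeromorphicContinuation (f : ℝ[X]) (U : Set ℂ) (Z : ℂ → ℂ) : Prop where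
  isOpen : IsOpen U
  isPreconnected : IsPreconnected U
  halfPlane_subset : halfPlane f ⊆ U
  meromorphicOn : MeromorphicOn Z U
  eqOn : EqOn Z (series f) (halfPlane f)

/-- `F_f(a, s) = ∫_0^∞ f(x)^(-a) x^(s-1) dx`, for `d Re a > Re s > 0`. -/
def F (f : ℝ[X]) (a s : ℂ) : ℂ :=
  ∫ x in Ioi (0 : ℝ), ((f.eval x : ℝ) : ℂ) ^ (-a) * (x : ℂ) ^ (s - 1)

/-- `Z` has a simple pole at `z` with residue `R`. -/
structure HasSimplePoleWithResidue (Z : ℂ → ℂ) (z R : ℂ) : Prop where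
  meromorphicAt : MeromorphicAt Z z
  order_eq : meromorphicOrderAt Z z = -1
  residue_eq : Tendsto (fun s : ℂ => (s - z) * Z s) (𝓝[≠] z) (𝓝 R)

end WittenZeta

end

/-!
Write `q(t) = t f(t)` (`profile`) and `A = d + 2`. By homogeneity the general term of the double
series is `m^(-As) q(n/m)^(-s)`, so for fixed `m` the sum over `n` is `m^(1-As)` times a Riemann sum
of mesh `1/m` for `J(s) = ∫_0^∞ q(t)^(-s) dt`. Replacing each Riemann sum by its integral gives
`ζ_f(s) = ζ(As - 1) J(s) + E(s)`, where `ζ` is Riemann's zeta function and `E` is the double sum of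
the errors made on the intervals `((n-1)/m, n/m]`
(`stripContinuation`, `series_eq_stripContinuation`).

Positivity of `f` on `[0, ∞)` makes `f` comparable to `(1 + t)^d` there (`exists_le_eval`). Hence
`J` converges and is holomorphic on the strip `1/(d+1) < Re s < 1`, and `q(t)^(-s)` has derivative
`O(|s| t^(-Re s - 1))`. With the mean value theorem for `n ≥ 2` and integrability at the origin for
`n = 1`, the error term of index `(n, m)` is `O(n^(-1-Re s) m^(-(d+1) Re s))`
(`exists_norm_defect_le`), so `E` is holomorphic on the strip too. As `d ≥ 1`, the strip
contains `2/(d+2)` in its interior, and there `ζ(As - 1)` has a simple pole with residue `1/A`, while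
`J(2/(d+2)) > 0`. Any other meromorphic continuation agrees with this one near the point, because
both equal the series at points of the half-plane accumulating there.
-/

namespace WittenZeta

/-! ### Polynomials positive on the half-line -/

/-- The polynomial function `t ↦ t f(t)`; by homogeneity
`n m^(d+1) f(n/m) = m^(d+2) * profile f (n/m)`. -/
noncomputable def profile (f : ℝ[X]) (t : ℝ) : ℝ := t * f.eval t

lemma exists_abs_eval_le (p : ℝ[X]) {d : ℕ} (hp : p.natDegree ≤ d) :
    ∃ C : ℝ, 0 ≤ C ∧ ∀ t : ℝ, 0 ≤ t → |p.eval t| ≤ C * (1 + t) ^ d := by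
  refine ⟨∑ i ∈ Finset.range (d + 1), |p.coeff i|, Finset.sum_nonneg fun _ _ => abs_nonneg _, ?_⟩
  intro t ht
  rw [Polynomial.eval_eq_sum_range' (Nat.lt_succ_of_le hp), Finset.sum_mul]
  refine (Finset.abs_sum_le_sum_abs _ _).trans (Finset.sum_le_sum fun i hi => ?_)
  rw [abs_mul, abs_of_nonneg (pow_nonneg ht i)]
  gcongr
  calc t ^ i ≤ (1 + t) ^ i := by gcongr; linarith
    _ ≤ (1 + t) ^ d := pow_le_pow_right₀ (by linarith) (by simpa [Nat.lt_succ_iff] using hi)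

/-- A polynomial positive on `[0, ∞)` is bounded below there by a multiple of `(1 + t)^d`: the
quotient is continuous and positive, and its limit at infinity is the leading coefficient. -/
lemma exists_le_eval {f : ℝ[X]} (hpos : ∀ x : ℝ, 0 ≤ x → 0 < f.eval x) :
    ∃ c : ℝ, 0 < c ∧ c ≤ 1 ∧ ∀ t : ℝ, 0 ≤ t → c * (1 + t) ^ f.natDegree ≤ f.eval t := by
  set d := f.natDegree with hd
  have hf0 : f ≠ 0 := by
    rintro rfl
    simpa using hpos 0 le_rfl
  set g : ℝ[X] := (X + C 1) ^ d with hg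
  have hgm : g.Monic := (monic_X_add_C 1).pow d
  have hgdeg : g.degree = d := by
    rw [hg, degree_pow, degree_X_add_C]; simp
  have hge : ∀ t, g.eval t = (1 + t) ^ d := fun t => by simp [hg, add_comm]
  have hlim := div_tendsto_atTop_leadingCoeff_div_of_degree_eq f g
    (by rw [hgdeg, degree_eq_natDegree hf0])
  rw [hgm.leadingCoeff, div_one] at hlim
  have hratio : ∀ t : ℝ, 0 ≤ t → 0 < f.eval t / g.eval t := fun t ht => by
    rw [hge]; exact div_pos (hpos t ht) (by positivity)
  have hlc : 0 < f.leadingCoeff := by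
    refine lt_of_le_of_ne (ge_of_tendsto hlim ?_) (leadingCoeff_ne_zero.mpr hf0).symm
    filter_upwards [eventually_ge_atTop 0] with t ht using (hratio t ht).le
  obtain ⟨T, hT⟩ := eventually_atTop.mp (hlim.eventually_const_lt (half_lt_self hlc))
  have hcont : ContinuousOn (fun t => f.eval t / g.eval t) (Icc 0 (max T 0)) :=
    f.continuousOn.div g.continuousOn fun t ht => by
      have := ht.1
      rw [hge]; positivity
  obtain ⟨x, hx, hmin⟩ := isCompact_Icc.exists_isMinOn ⟨0, by simp⟩ hcont
  have hx0 := hratio x hx.1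
  refine ⟨min 1 (min (f.leadingCoeff / 2) (f.eval x / g.eval x)), by positivity, min_le_left _ _,
    fun t ht => ?_⟩
  rw [← hge, ← le_div_iff₀ (by rw [hge]; positivity)]
  refine (min_le_right _ _).trans ?_
  rcases le_total t (max T 0) with h | h
  · exact (min_le_right _ _).trans (hmin ⟨ht, h⟩)
  · exact (min_le_left _ _).trans (hT t ((le_max_left _ _).trans h)).le

/-! ### The kernel and its integral -/

/-- The complex power `(t f(t))^(-s)`. -/
noncomputable def kernel (f : ℝ[X]) (s : ℂ) (t : ℝ) : ℂ := ((profile f t : ℝ) : ℂ) ^ (-s)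

/-- The strip `1/(d+1) < Re s < 1`, on which `∫_0^∞ (t f(t))^(-s) dt` converges
when `f > 0` on `[0, ∞)`. The lower bound is stated without division. -/
def strip (f : ℝ[X]) : Set ℂ := {s : ℂ | 1 < (f.natDegree + 1) * s.re ∧ s.re < 1}

lemma isOpen_strip (f : ℝ[X]) : IsOpen (strip f) :=
  (isOpen_lt continuous_const (continuous_const.mul Complex.continuous_re)).inter
    (isOpen_lt Complex.continuous_re continuous_const)

lemma re_pos_of_mem_strip {f : ℝ[X]} {s : ℂ} (hs : s ∈ strip f) : 0 < s.re := by
  have h := hs.1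
  by_contra hn
  have : ((f.natDegree : ℝ) + 1) * s.re ≤ 0 :=
    mul_nonpos_of_nonneg_of_nonpos (by positivity) (not_lt.mp hn)
  linarith

lemma continuous_profile (f : ℝ[X]) : Continuous (profile f) := continuous_id.mul f.continuous

section

variable {f : ℝ[X]} (hpos : ∀ x : ℝ, 0 ≤ x → 0 < f.eval x)
include hpos

lemma profile_pos {t : ℝ} (ht : 0 < t) : 0 < profile f t := mul_pos ht (hpos t ht.le)

lemma norm_kernel (s : ℂ) {t : ℝ} (ht : 0 < t) : ‖kernel f s t‖ = profile f t ^ (-s.re) := by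
  rw [kernel, Complex.norm_cpow_eq_rpow_re_of_pos (profile_pos hpos ht), Complex.neg_re]

lemma integrableOn_profile_rpow {σ : ℝ} (h1 : 1 < ((f.natDegree : ℝ) + 1) * σ) (h2 : σ < 1) :
    IntegrableOn (fun t => profile f t ^ (-σ)) (Ioi 0) := by
  have hσ : 0 < σ := re_pos_of_mem_strip (f := f) (s := (σ : ℂ)) (by simpa [strip] using ⟨h1, h2⟩)
  obtain ⟨c, hc, -, hle⟩ := exists_le_eval hpos
  have hmeas : Measurable fun t => profile f t ^ (-σ) :=
    (continuous_profile f).measurable.pow_const _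
  have key : ∀ t : ℝ, 0 < t → ∀ b : ℝ, 0 < b → b ≤ profile f t →
      ‖profile f t ^ (-σ)‖ ≤ b ^ (-σ) := fun t ht b hb h => by
    rw [Real.norm_of_nonneg (Real.rpow_nonneg (profile_pos hpos ht).le _)]
    exact Real.rpow_le_rpow_of_nonpos hb h (by linarith)
  rw [← Ioc_union_Ioi_eq_Ioi (zero_le_one' ℝ)]
  refine IntegrableOn.union ?_ ?_
  · have hI : IntegrableOn (fun t : ℝ => c ^ (-σ) * t ^ (-σ)) (Ioc 0 1) :=
      ((intervalIntegrable_iff_integrableOn_Ioc_of_le zero_le_one).mp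
        (intervalIntegral.intervalIntegrable_rpow' (by linarith))).const_mul _
    refine hI.mono' hmeas.aestronglyMeasurable ?_
    filter_upwards [ae_restrict_mem measurableSet_Ioc] with t ht
    rw [← Real.mul_rpow hc.le ht.1.le]
    refine key t ht.1 _ (mul_pos hc ht.1) ?_
    rw [profile, mul_comm]
    refine mul_le_mul_of_nonneg_left (le_trans ?_ (hle t ht.1.le)) ht.1.le
    exact le_mul_of_one_le_right hc.le (one_le_pow₀ (by linarith [ht.1]))
  · have hI : IntegrableOn (fun t : ℝ => c ^ (-σ) * t ^ (((f.natDegree : ℝ) + 1) * (-σ))) (Ioi 1) :=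
      (integrableOn_Ioi_rpow_of_lt (by linarith) one_pos).const_mul _
    refine hI.mono' hmeas.aestronglyMeasurable ?_
    filter_upwards [ae_restrict_mem measurableSet_Ioi] with t ht
    have ht0 : 0 < t := one_pos.trans ht
    rw [Real.rpow_mul ht0.le, ← Real.mul_rpow hc.le (by positivity)]
    refine key t ht0 _ (by positivity) ?_
    rw [show ((f.natDegree : ℝ) + 1) = ((f.natDegree + 1 : ℕ) : ℝ) by push_cast; rfl,
      Real.rpow_natCast, pow_succ, ← mul_assoc, profile, mul_comm]
    refine mul_le_mul_of_nonneg_left (le_trans ?_ (hle t ht0.le)) ht0.le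
    gcongr
    linarith

lemma integrableOn_kernel {s : ℂ} (hs : s ∈ strip f) : IntegrableOn (kernel f s) (Ioi 0) := by
  refine (integrableOn_profile_rpow hpos hs.1 hs.2).mono' ?_ ?_
  · exact ((Complex.measurable_ofReal.comp (continuous_profile f).measurable).pow_const
      _).aestronglyMeasurable
  · filter_upwards [ae_restrict_mem measurableSet_Ioi] with t ht
    rw [norm_kernel hpos s ht]

/-- Integrals of `(t f(t))^(-s)` are complex moment generating functions of `log (t f(t))`, hence
holomorphic on the strip. -/
lemma differentiableOn_integral_kernel {S : Set ℝ} (hS : S ⊆ Ioi 0) (hSm : MeasurableSet S) :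
    DifferentiableOn ℂ (fun s => ∫ t in S, kernel f s t) (strip f) := by
  intro s hs
  have heq : ∀ z : ℂ, ProbabilityTheory.complexMGF (fun t => Real.log (profile f t))
      (volume.restrict S) (-z) = ∫ t in S, kernel f z t := fun z => by
    refine setIntegral_congr_fun hSm fun t ht => ?_
    have hp := profile_pos hpos (hS ht)
    rw [kernel, Complex.cpow_def_of_ne_zero (Complex.ofReal_ne_zero.mpr hp.ne'),
      Complex.ofReal_log hp.le, mul_comm]
  set V : Set ℝ := {x | 1 < ((f.natDegree : ℝ) + 1) * (-x) ∧ -x < 1} with hV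
  have hVo : IsOpen V :=
    (isOpen_lt (continuous_const (y := (1 : ℝ)))
      (by fun_prop : Continuous fun x : ℝ => ((f.natDegree : ℝ) + 1) * (-x))).inter
    (isOpen_lt (continuous_neg (G := ℝ)) (continuous_const (y := (1 : ℝ))))
  have hsub : V ⊆ ProbabilityTheory.integrableExpSet (fun t => Real.log (profile f t))
      (volume.restrict S) := fun x hx => by
    have h := (integrableOn_profile_rpow hpos hx.1 hx.2).mono_set hS
    refine (integrableOn_congr_fun (fun t ht => ?_) hSm).mp h
    have hp := profile_pos hpos (hS ht)
    simp only [neg_neg, Real.rpow_def_of_pos hp, mul_comm]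
  have hmem : (-s).re ∈ interior (ProbabilityTheory.integrableExpSet
      (fun t => Real.log (profile f t)) (volume.restrict S)) :=
    interior_maximal hsub hVo (by simpa [hV, strip] using hs)
  have hd := (ProbabilityTheory.hasDerivAt_complexMGF hmem).differentiableAt.comp s
    differentiableAt_id.neg
  refine (hd.congr_of_eventuallyEq (Eventually.of_forall fun z => ?_)).differentiableWithinAt
  exact (heq z).symm

end

lemma summable_pnat_rpow {x : ℝ} (hx : x < -1) : Summable fun n : ℕ+ => (n : ℝ) ^ x :=
  (Real.summable_nat_rpow.mpr hx).comp_injective PNat.coe_injective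

lemma base_eq_profile (f : ℝ[X]) (n m : ℕ+) :
    base f n m = (m : ℝ) ^ (f.natDegree + 2) * profile f ((n : ℝ) / m) := by
  have : (m : ℝ) ≠ 0 := by exact_mod_cast m.ne_zero
  rw [base, profile]
  field_simp
  ring

/-! ### Errors of the Riemann sums -/

/-- The interval `((n-1)/m, n/m]`; for fixed `m` these intervals partition `(0, ∞)`. -/
def cell (n m : ℕ+) : Set ℝ := Ioc (((n : ℝ) - 1) / m) ((n : ℝ) / m)

/-- The error of the one-cell Riemann sum for `(t f(t))^(-s)` with mesh `1/m`, scaled by `m`. -/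
noncomputable def riemannError (f : ℝ[X]) (s : ℂ) (n m : ℕ+) : ℂ :=
  kernel f s ((n : ℝ) / m) - m * ∫ t in cell n m, kernel f s t

/-- The difference between a term of the double series and the corresponding cell integral. -/
noncomputable def defect (f : ℝ[X]) (s : ℂ) (p : ℕ+ × ℕ+) : ℂ :=
  ((p.2 : ℝ) : ℂ) ^ (-((f.natDegree + 2 : ℕ) : ℂ) * s) * riemannError f s p.1 p.2

lemma cell_subset (n m : ℕ+) : cell n m ⊆ Ioi 0 := fun t ht => by
  have hn : (1 : ℝ) ≤ n := by exact_mod_cast one_le (a := n)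
  exact lt_of_le_of_lt (div_nonneg (by linarith) (by positivity)) ht.1

lemma iUnion_cell (m : ℕ+) : ⋃ n : ℕ+, cell n m = Ioi 0 := by
  refine Subset.antisymm (iUnion_subset fun n => cell_subset n m) fun t ht => ?_
  have hm : (0 : ℝ) < m := by exact_mod_cast m.pos
  have htm : 0 < t * m := mul_pos ht hm
  refine mem_iUnion.mpr ⟨⟨⌈t * m⌉₊, Nat.ceil_pos.mpr htm⟩, ?_, ?_⟩
  · rw [div_lt_iff₀ hm]
    have := Nat.ceil_lt_add_one htm.le
    simp only [PNat.mk_coe]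
    linarith
  · rw [le_div_iff₀ hm]
    exact Nat.le_ceil _

lemma pairwise_disjoint_cell (m : ℕ+) :
    Pairwise (Function.onFun Disjoint fun n : ℕ+ => cell n m) := by
  have hm : (0 : ℝ) < m := by exact_mod_cast m.pos
  refine (pairwise_disjoint_on _).mpr fun n k hnk => ?_
  have hnk' : (n : ℝ) + 1 ≤ k := by exact_mod_cast hnk
  rw [cell, cell, Ioc_disjoint_Ioc]
  refine (min_le_left _ _).trans (le_trans ?_ (le_max_right _ _))
  gcongr
  linarith

section

variable {f : ℝ[X]} (hpos : ∀ x : ℝ, 0 ≤ x → 0 < f.eval x)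
include hpos

lemma hasSum_integral_cell {s : ℂ} (hs : s ∈ strip f) (m : ℕ+) :
    HasSum (fun n : ℕ+ => ∫ t in cell n m, kernel f s t) (∫ t in Ioi 0, kernel f s t) := by
  rw [← iUnion_cell m]
  exact hasSum_integral_iUnion (fun n => measurableSet_Ioc) (pairwise_disjoint_cell m)
    (by rw [iUnion_cell]; exact integrableOn_kernel hpos hs)

lemma exists_norm_kernel_le :
    ∃ C : ℝ, 0 < C ∧ ∀ s ∈ strip f, ∀ t : ℝ, 0 < t → ‖kernel f s t‖ ≤ C * t ^ (-s.re) := by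
  obtain ⟨c, hc, hc1, hle⟩ := exists_le_eval hpos
  refine ⟨c⁻¹, inv_pos.mpr hc, fun s hs t ht => ?_⟩
  have hσ := re_pos_of_mem_strip hs
  rw [norm_kernel hpos s ht]
  calc profile f t ^ (-s.re) ≤ (c * t) ^ (-s.re) := by
        refine Real.rpow_le_rpow_of_nonpos (by positivity) ?_ (by linarith)
        rw [profile, mul_comm]
        refine mul_le_mul_of_nonneg_left (le_trans ?_ (hle t ht.le)) ht.le
        exact le_mul_of_one_le_right hc.le (one_le_pow₀ (by linarith))
    _ = c ^ (-s.re) * t ^ (-s.re) := Real.mul_rpow hc.le ht.le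
    _ ≤ c⁻¹ * t ^ (-s.re) := by
        gcongr
        rw [← Real.rpow_neg_one]
        exact Real.rpow_le_rpow_of_exponent_ge hc hc1 (by linarith [hs.2])

/-- The logarithmic derivative of `t f(t)` is `O(1/t)`, since `f` is comparable to `(1 + t)^d`. -/
lemma exists_abs_deriv_profile_le :
    ∃ C : ℝ, 0 < C ∧ ∀ t : ℝ, 0 < t →
      |f.eval t + t * f.derivative.eval t| ≤ C * (profile f t / t) := by
  obtain ⟨c, hc, -, hle⟩ := exists_le_eval hpos
  have hdeg : (f + X * derivative f).natDegree ≤ f.natDegree := by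
    refine (natDegree_add_le _ _).trans (max_le le_rfl ?_)
    rcases Nat.eq_zero_or_pos f.natDegree with h | h
    · rw [Polynomial.derivative_of_natDegree_zero h]; simp
    · refine natDegree_mul_le.trans ?_
      have := natDegree_derivative_le f
      have := natDegree_X_le (R := ℝ)
      omega
  obtain ⟨C, hC, hub⟩ := exists_abs_eval_le _ hdeg
  refine ⟨(C + 1) / c, by positivity, fun t ht => ?_⟩
  have h1 := hub t ht.le
  simp only [eval_add, eval_mul, eval_X] at h1
  have h2 := hle t ht.le
  have h3 : profile f t / t = f.eval t := by rw [profile]; field_simp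
  rw [h3, div_mul_eq_mul_div, le_div_iff₀ hc]
  have h4 : 0 ≤ (1 + t) ^ f.natDegree := by positivity
  nlinarith

lemma hasDerivAt_kernel (s : ℂ) {t : ℝ} (ht : 0 < t) :
    HasDerivAt (kernel f s) (-s * ((profile f t : ℝ) : ℂ) ^ (-s - 1) *
      ((f.eval t + t * f.derivative.eval t : ℝ) : ℂ)) t := by
  have hp := profile_pos hpos ht
  have h1 : HasDerivAt (profile f) (f.eval t + t * f.derivative.eval t) t := by
    have h := (hasDerivAt_id t).mul (f.hasDerivAt t)
    rw [one_mul] at h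
    exact h
  have h2 : HasDerivAt (fun z : ℂ => z ^ (-s)) (-s * ((profile f t : ℝ) : ℂ) ^ (-s - 1))
      ((profile f t : ℝ) : ℂ) := by
    simpa using (hasDerivAt_id ((profile f t : ℝ) : ℂ)).cpow_const
      (c := -s) (Complex.ofReal_mem_slitPlane.mpr hp)
  exact h2.comp t h1.ofReal_comp

/-- Mean value estimate on `[a, ∞)`, from `|d/dt (t f(t))^(-s)| = O(|s| t^(-Re s - 1))`. -/
lemma exists_norm_kernel_sub_le :
    ∃ K : ℝ, 0 < K ∧ ∀ s ∈ strip f, ∀ a x y : ℝ, 0 < a → a ≤ x → a ≤ y →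
      ‖kernel f s x - kernel f s y‖ ≤ K * ‖s‖ * a ^ (-s.re - 1) * |x - y| := by
  obtain ⟨C, hC, hk⟩ := exists_norm_kernel_le hpos
  obtain ⟨D, hD, hd⟩ := exists_abs_deriv_profile_le hpos
  refine ⟨D * C, by positivity, fun s hs a x y ha hx hy => ?_⟩
  have hσ := re_pos_of_mem_strip hs
  refine Convex.norm_image_sub_le_of_norm_hasDerivWithin_le (s := Ici a)
    (fun t ht => (hasDerivAt_kernel hpos s (ha.trans_le ht)).hasDerivWithinAt)
    (fun t ht => ?_) (convex_Ici a) hy hx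
  have ht0 : 0 < t := ha.trans_le ht
  have hp := profile_pos hpos ht0
  rw [norm_mul, norm_mul, norm_neg, Complex.norm_cpow_eq_rpow_re_of_pos hp, Complex.norm_real,
    Real.norm_eq_abs]
  have h1 := hd t ht0
  have h2 := hk s hs t ht0
  rw [norm_kernel hpos s ht0] at h2
  have h3 : profile f t ^ (-s - 1).re = profile f t ^ (-s.re) / profile f t := by
    rw [← Real.rpow_sub_one hp.ne']; simp
  calc ‖s‖ * profile f t ^ (-s - 1).re * |f.eval t + t * f.derivative.eval t|
      ≤ ‖s‖ * (profile f t ^ (-s.re) / profile f t) * (D * (profile f t / t)) := by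
        rw [h3]; gcongr
    _ = D * ‖s‖ * (profile f t ^ (-s.re) / t) := by field_simp
    _ ≤ D * ‖s‖ * (C * t ^ (-s.re) / t) := by gcongr
    _ = D * C * ‖s‖ * t ^ (-s.re - 1) := by rw [Real.rpow_sub_one ht0.ne']; ring
    _ ≤ D * C * ‖s‖ * a ^ (-s.re - 1) := by
        gcongr ?_ * ?_
        exact Real.rpow_le_rpow_of_nonpos ha ht (by linarith)

/-- In the first cell the kernel is merely integrable, so the sample value and the integral are
bounded separately. -/
lemma exists_norm_riemannError_one_le :
    ∃ C : ℝ, 0 < C ∧ ∀ s ∈ strip f, ∀ m : ℕ+,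
      ‖riemannError f s 1 m‖ ≤ C * (1 / (1 - s.re)) * (m : ℝ) ^ s.re := by
  obtain ⟨C, hC, hk⟩ := exists_norm_kernel_le hpos
  refine ⟨2 * C, by positivity, fun s hs m => ?_⟩
  have hσ := re_pos_of_mem_strip hs
  have hσ1 : 0 < 1 - s.re := sub_pos.mpr hs.2
  have hm : (0 : ℝ) < m := by exact_mod_cast m.pos
  have hcell : cell 1 m = Ioc 0 (1 / (m : ℝ)) := by simp [cell]
  have h1 : ‖kernel f s (((1 : ℕ+) : ℝ) / m)‖ ≤ C * (m : ℝ) ^ s.re := by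
    refine (hk s hs _ (by simp)).trans_eq ?_
    simp [Real.inv_rpow hm.le, Real.rpow_neg hm.le]
  have h2 : ‖∫ t in cell 1 m, kernel f s t‖ ≤ C * ((1 / (m : ℝ)) ^ (1 - s.re) / (1 - s.re)) := by
    have hI : IntegrableOn (fun t : ℝ => C * t ^ (-s.re)) (Ioc 0 (1 / (m : ℝ))) :=
      ((intervalIntegrable_iff_integrableOn_Ioc_of_le (by positivity)).mp
        (intervalIntegral.intervalIntegrable_rpow' (by linarith [hs.2]))).const_mul _
    rw [hcell]
    refine (norm_integral_le_of_norm_le hI ?_).trans_eq ?_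
    · filter_upwards [ae_restrict_mem measurableSet_Ioc] with t ht using hk s hs t ht.1
    · rw [integral_const_mul, ← intervalIntegral.integral_of_le (by positivity),
        integral_rpow (Or.inl (by linarith [hs.2])), Real.zero_rpow (by linarith)]
      rw [sub_zero, neg_add_eq_sub]
  have h3 : (m : ℝ) * (C * ((1 / (m : ℝ)) ^ (1 - s.re) / (1 - s.re))) =
      C * (1 / (1 - s.re)) * (m : ℝ) ^ s.re := by
    rw [Real.div_rpow zero_le_one hm.le, Real.one_rpow, Real.rpow_sub hm, Real.rpow_one]
    field_simp
  have h4 : C * (m : ℝ) ^ s.re ≤ C * (1 / (1 - s.re)) * (m : ℝ) ^ s.re := by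
    gcongr
    refine le_mul_of_one_le_right hC.le ?_
    rw [le_div_iff₀ hσ1]; linarith
  calc ‖riemannError f s 1 m‖
      ≤ ‖kernel f s (((1 : ℕ+) : ℝ) / m)‖ + (m : ℝ) * ‖∫ t in cell 1 m, kernel f s t‖ := by
        refine (norm_sub_le _ _).trans_eq ?_
        simp
    _ ≤ C * (m : ℝ) ^ s.re + m * (C * ((1 / (m : ℝ)) ^ (1 - s.re) / (1 - s.re))) := by gcongr
    _ ≤ _ := by rw [h3]; linarith

/-- Away from the origin the error is controlled by the mean value theorem. -/
lemma exists_norm_riemannError_le_of_two_le :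
    ∃ K : ℝ, 0 < K ∧ ∀ s ∈ strip f, ∀ n m : ℕ+, 2 ≤ n →
      ‖riemannError f s n m‖ ≤ K * ‖s‖ * (n : ℝ) ^ (-s.re - 1) * (m : ℝ) ^ s.re := by
  obtain ⟨K, hK, hk⟩ := exists_norm_kernel_sub_le hpos
  refine ⟨4 * K, by positivity, fun s hs n m hn => ?_⟩
  have hσ := re_pos_of_mem_strip hs
  have hm : (0 : ℝ) < m := by exact_mod_cast m.pos
  have hn2 : (2 : ℝ) ≤ n := by exact_mod_cast hn
  have hn0 : (0 : ℝ) < n := by linarith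
  set a : ℝ := ((n : ℝ) - 1) / m with ha
  have ha0 : 0 < a := div_pos (by linarith) hm
  have hlen : (n : ℝ) / m - a = 1 / m := by rw [ha]; field_simp; ring
  have han : a ≤ (n : ℝ) / m := by
    have : 0 < 1 / (m : ℝ) := by positivity
    linarith
  have hvol : volume.real (cell n m) = 1 / m := by
    rw [cell, Real.volume_real_Ioc_of_le han, hlen]
  have hfin : volume (cell n m) < ⊤ := measure_Ioc_lt_top
  have hint : IntegrableOn (kernel f s) (cell n m) :=
    (integrableOn_kernel hpos hs).mono_set (cell_subset n m)
  have hconst : IntegrableOn (fun _ : ℝ => kernel f s ((n : ℝ) / m)) (cell n m) :=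
    integrableOn_const hfin.ne
  have heq : riemannError f s n m =
      m * ∫ t in cell n m, (kernel f s ((n : ℝ) / m) - kernel f s t) := by
    rw [integral_sub hconst hint, setIntegral_const, hvol, riemannError,
      Complex.real_smul]
    have : (m : ℂ) ≠ 0 := by exact_mod_cast m.ne_zero
    push_cast
    field_simp
  have hbound : ∀ t ∈ cell n m, ‖kernel f s ((n : ℝ) / m) - kernel f s t‖ ≤
      K * ‖s‖ * a ^ (-s.re - 1) * (1 / m) := fun t ht => by
    refine (hk s hs a _ t ha0 han ht.1.le).trans ?_
    gcongr
    rw [abs_of_nonneg (sub_nonneg.mpr ht.2), ← hlen]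
    linarith [ht.1]
  -- Since `n - 1 ≥ n / 2` and `Re s < 1`, replacing `n - 1` by `n` costs at most `2 ^ 2`.
  have hpow : a ^ (-s.re - 1) ≤ 4 * ((n : ℝ) ^ (-s.re - 1) * (m : ℝ) ^ (s.re + 1)) := by
    calc a ^ (-s.re - 1) ≤ ((2 : ℝ)⁻¹ * (n * (m : ℝ)⁻¹)) ^ (-s.re - 1) := by
          refine Real.rpow_le_rpow_of_nonpos (by positivity) ?_ (by linarith)
          rw [ha, div_eq_mul_inv, ← mul_assoc]
          gcongr
          linarith
      _ = 2 ^ (s.re + 1) * ((n : ℝ) ^ (-s.re - 1) * (m : ℝ) ^ (s.re + 1)) := by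
          rw [Real.mul_rpow (by positivity) (by positivity),
            Real.mul_rpow (by positivity) (by positivity), Real.inv_rpow (by positivity),
            Real.inv_rpow (by positivity), ← Real.rpow_neg (by positivity),
            ← Real.rpow_neg (by positivity)]
          ring_nf
      _ ≤ 4 * ((n : ℝ) ^ (-s.re - 1) * (m : ℝ) ^ (s.re + 1)) := by
          gcongr
          calc (2 : ℝ) ^ (s.re + 1) ≤ 2 ^ (2 : ℝ) :=
                Real.rpow_le_rpow_of_exponent_le one_le_two (by linarith [hs.2])
            _ = 4 := by norm_num
  calc ‖riemannError f s n m‖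
      ≤ m * (K * ‖s‖ * a ^ (-s.re - 1) * (1 / m) * (1 / m)) := by
        rw [heq, norm_mul, Complex.norm_natCast]
        gcongr
        rw [← hvol]
        simpa only [hvol] using norm_setIntegral_le_of_norm_le_const hfin hbound
    _ = K * ‖s‖ * a ^ (-s.re - 1) * (1 / m) := by field_simp
    _ ≤ K * ‖s‖ * (4 * ((n : ℝ) ^ (-s.re - 1) * (m : ℝ) ^ (s.re + 1))) * (1 / m) := by gcongr
    _ = _ := by rw [Real.rpow_add_one hm.ne']; field_simp

/-- The exponents of `n` and `m` in the bound are both less than `-1` on the strip. -/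
lemma exists_norm_defect_le :
    ∃ L : ℝ, 0 < L ∧ ∀ s ∈ strip f, ∀ p : ℕ+ × ℕ+,
      ‖defect f s p‖ ≤ L * (1 / (1 - s.re) + ‖s‖) *
        ((p.1 : ℝ) ^ (-s.re - 1) * (p.2 : ℝ) ^ (-(((f.natDegree : ℝ) + 1) * s.re))) := by
  obtain ⟨C, hC, h1⟩ := exists_norm_riemannError_one_le hpos
  obtain ⟨K, hK, h2⟩ := exists_norm_riemannError_le_of_two_le hpos
  refine ⟨C + K, by positivity, fun s hs ⟨n, m⟩ => ?_⟩
  have hσ1 : 0 < 1 - s.re := sub_pos.mpr hs.2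
  have hm : (0 : ℝ) < m := by exact_mod_cast m.pos
  have hn : (0 : ℝ) < n := by exact_mod_cast n.pos
  have hi : 0 < 1 / (1 - s.re) := by positivity
  have hs0 := norm_nonneg s
  have key : ‖riemannError f s n m‖ ≤
      (C + K) * (1 / (1 - s.re) + ‖s‖) * ((n : ℝ) ^ (-s.re - 1) * (m : ℝ) ^ s.re) := by
    have hX : 0 ≤ (n : ℝ) ^ (-s.re - 1) * (m : ℝ) ^ s.re := by positivity
    rcases eq_or_lt_of_le (one_le (a := n)) with h | h
    · subst h
      refine (h1 s hs m).trans ?_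
      simp only [PNat.one_coe, Nat.cast_one, Real.one_rpow, one_mul]
      gcongr
      · linarith
      · linarith
    · refine (h2 s hs n m (PNat.add_one_le_iff.mpr h)).trans ?_
      rw [mul_assoc (K * ‖s‖)]
      gcongr
      · linarith
      · linarith
  have hexp : (m : ℝ) ^ (-(((f.natDegree : ℝ) + 2) * s.re)) * (m : ℝ) ^ s.re =
      (m : ℝ) ^ (-(((f.natDegree : ℝ) + 1) * s.re)) := by
    rw [← Real.rpow_add hm]
    ring_nf
  have hre : (-((f.natDegree + 2 : ℕ) : ℂ) * s).re = -(((f.natDegree : ℝ) + 2) * s.re) := by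
    rw [← Complex.ofReal_natCast, ← Complex.ofReal_neg, Complex.re_ofReal_mul]
    push_cast
    ring
  rw [defect, norm_mul, Complex.norm_cpow_eq_rpow_re_of_pos hm, hre]
  calc (m : ℝ) ^ (-(((f.natDegree : ℝ) + 2) * s.re)) * ‖riemannError f s n m‖
      ≤ (m : ℝ) ^ (-(((f.natDegree : ℝ) + 2) * s.re)) *
        ((C + K) * (1 / (1 - s.re) + ‖s‖) * ((n : ℝ) ^ (-s.re - 1) * (m : ℝ) ^ s.re)) := by gcongr
    _ = _ := by rw [← hexp]; ring

lemma summable_defect {s : ℂ} (hs : s ∈ strip f) : Summable (defect f s) := by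
  obtain ⟨L, hL, h⟩ := exists_norm_defect_le hpos
  have hσ := re_pos_of_mem_strip hs
  refine Summable.of_norm_bounded (Summable.mul_left _ ?_) (h s hs)
  exact (summable_pnat_rpow (by linarith)).mul_of_nonneg (summable_pnat_rpow (by linarith [hs.1]))
    (fun n => by positivity) (fun n => by positivity)

lemma differentiableOn_tsum_defect :
    DifferentiableOn ℂ (fun s => ∑' p, defect f s p) (strip f) := by
  intro s₀ hs₀
  have hσ₀ := re_pos_of_mem_strip hs₀
  obtain ⟨L, hL, h⟩ := exists_norm_defect_le hpos
  have hd1 : (0 : ℝ) < (f.natDegree : ℝ) + 1 := by positivity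
  obtain ⟨a, ha1, ha2⟩ := exists_between
    (show 1 / ((f.natDegree : ℝ) + 1) < s₀.re by
      rw [div_lt_iff₀ hd1, mul_comm]; exact hs₀.1)
  obtain ⟨b, hb1, hb2⟩ := exists_between hs₀.2
  have ha0 : 0 < a := lt_trans (by positivity) ha1
  rw [div_lt_iff₀ hd1, mul_comm] at ha1
  -- On `R` both `1 / (1 - Re s)` and `‖s‖` are bounded, so one summable majorant serves all `s`.
  set R : Set ℂ := {s : ℂ | a < s.re ∧ s.re < b ∧ ‖s‖ < ‖s₀‖ + 1} with hR
  have hRo : IsOpen R := (isOpen_lt continuous_const Complex.continuous_re).inter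
    ((isOpen_lt Complex.continuous_re continuous_const).inter
      (isOpen_lt continuous_norm continuous_const))
  have hRsub : R ⊆ strip f := fun s hs =>
    ⟨ha1.trans (mul_lt_mul_of_pos_left hs.1 hd1), hs.2.1.trans hb2⟩
  have hs₀R : s₀ ∈ R := ⟨ha2, hb1, by linarith⟩
  have hterm : ∀ p : ℕ+ × ℕ+, DifferentiableOn ℂ (fun s => defect f s p) (strip f) := by
    rintro ⟨n, m⟩ s hs
    have hm : ((m : ℝ) : ℂ) ≠ 0 := by exact_mod_cast m.ne_zero
    have hn : (0 : ℝ) < (n : ℝ) / m :=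
      div_pos (by exact_mod_cast n.pos) (by exact_mod_cast m.pos)
    have h1 : DifferentiableAt ℂ
        (fun s : ℂ => ((m : ℝ) : ℂ) ^ (-((f.natDegree + 2 : ℕ) : ℂ) * s)) s :=
      (differentiableAt_id.const_mul _).const_cpow (Or.inl hm)
    have h2 : DifferentiableAt ℂ (fun s : ℂ => kernel f s ((n : ℝ) / m)) s :=
      differentiableAt_id.neg.const_cpow
        (Or.inl (Complex.ofReal_ne_zero.mpr (profile_pos hpos hn).ne'))
    exact h1.differentiableWithinAt.mul (h2.differentiableWithinAt.sub
      ((differentiableOn_integral_kernel hpos (cell_subset n m) measurableSet_Ioc s hs).const_mul _))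
  have hsum : Summable fun p : ℕ+ × ℕ+ => L * (1 / (1 - b) + (‖s₀‖ + 1)) *
      ((p.1 : ℝ) ^ (-a - 1) * (p.2 : ℝ) ^ (-(((f.natDegree : ℝ) + 1) * a))) :=
    Summable.mul_left _ ((summable_pnat_rpow (by linarith)).mul_of_nonneg
      (summable_pnat_rpow (by linarith)) (fun n => by positivity) (fun n => by positivity))
  have hD := Complex.differentiableOn_tsum_of_summable_norm hsum
    (fun p => (hterm p).mono hRsub) hRo (fun p s hs => ?_)
  · exact (hD.differentiableAt (hRo.mem_nhds hs₀R)).differentiableWithinAt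
  · refine (h s (hRsub hs) p).trans ?_
    have hp1 : (1 : ℝ) ≤ p.1 := by exact_mod_cast one_le (a := p.1)
    have hp2 : (1 : ℝ) ≤ p.2 := by exact_mod_cast one_le (a := p.2)
    have hb : 0 < 1 - b := by linarith
    have hsb : 0 < 1 - s.re := by linarith [hs.2.1]
    have e1 : (p.1 : ℝ) ^ (-s.re - 1) ≤ (p.1 : ℝ) ^ (-a - 1) :=
      Real.rpow_le_rpow_of_exponent_le hp1 (by linarith [hs.1])
    have e2 : (p.2 : ℝ) ^ (-(((f.natDegree : ℝ) + 1) * s.re)) ≤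
        (p.2 : ℝ) ^ (-(((f.natDegree : ℝ) + 1) * a)) :=
      Real.rpow_le_rpow_of_exponent_le hp2
        (neg_le_neg (mul_le_mul_of_nonneg_left hs.1.le hd1.le))
    have e3 : 1 / (1 - s.re) ≤ 1 / (1 - b) :=
      one_div_le_one_div_of_le hb (by linarith [hs.2.1])
    have e4 := hs.2.2.le
    gcongr

end

/-! ### Convergence in the half-plane -/

lemma abscissa_pos (f : ℝ[X]) : 0 < abscissa f := by unfold abscissa; positivity

lemma isOpen_halfPlane (f : ℝ[X]) : IsOpen (halfPlane f) :=
  isOpen_lt continuous_const Complex.continuous_re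

lemma one_lt_mul_of_abscissa_le {f : ℝ[X]} (hd : 1 ≤ f.natDegree) {x : ℝ} (hx : abscissa f ≤ x) :
    1 < ((f.natDegree : ℝ) + 1) * x := by
  have hd' : (1 : ℝ) ≤ f.natDegree := by exact_mod_cast hd
  rw [abscissa, div_le_iff₀ (by positivity)] at hx
  nlinarith

lemma one_lt_half_mul_of_abscissa_lt {f : ℝ[X]} {x : ℝ} (hx : abscissa f < x) :
    1 < ((f.natDegree : ℝ) + 2) / 2 * x := by
  rw [abscissa, div_lt_iff₀ (by positivity)] at hx
  linarith

lemma abscissa_lt_one {f : ℝ[X]} (hd : 1 ≤ f.natDegree) : abscissa f < 1 := by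
  have hd' : (1 : ℝ) ≤ f.natDegree := by exact_mod_cast hd
  rw [abscissa, div_lt_one (by positivity)]
  linarith

lemma abscissa_mem_strip {f : ℝ[X]} (hd : 1 ≤ f.natDegree) : (abscissa f : ℂ) ∈ strip f :=
  ⟨by simpa using one_lt_mul_of_abscissa_le hd le_rfl, by simpa using abscissa_lt_one hd⟩

section

variable {f : ℝ[X]} (hpos : ∀ x : ℝ, 0 ≤ x → 0 < f.eval x)
include hpos

lemma base_pos (n m : ℕ+) : 0 < base f n m := by
  have hm : (0 : ℝ) < m := by exact_mod_cast m.pos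
  have hn : (0 : ℝ) < n := by exact_mod_cast n.pos
  rw [base_eq_profile]
  exact mul_pos (by positivity) (profile_pos hpos (by positivity))

/-- Since `m^d f(n/m)` is comparable to `(n + m)^d ≥ (nm)^(d/2)`, the terms of the double series are
dominated by a product of two one-variable series with the same abscissa of convergence. -/
lemma exists_norm_term_le :
    ∃ c : ℝ, 0 < c ∧ c ≤ 1 ∧ ∀ (s : ℂ) (p : ℕ+ × ℕ+), 0 ≤ s.re →
      ‖term f s p‖ ≤ c ^ (-s.re) *
        ((p.1 : ℝ) ^ (-(((f.natDegree : ℝ) + 2) / 2 * s.re)) *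
          (p.2 : ℝ) ^ (-(((f.natDegree : ℝ) + 2) / 2 * s.re))) := by
  obtain ⟨c, hc, hc1, hle⟩ := exists_le_eval hpos
  refine ⟨c, hc, hc1, fun s ⟨n, m⟩ hs => ?_⟩
  have hm : (0 : ℝ) < m := by exact_mod_cast m.pos
  have hn : (0 : ℝ) < n := by exact_mod_cast n.pos
  set x := √((n : ℝ) * m) with hx
  have hx0 : 0 < x := Real.sqrt_pos.mpr (by positivity)
  have hx2 : x ^ 2 = n * m := Real.sq_sqrt (by positivity)
  have hxle : x ≤ m + n := by
    rw [hx, Real.sqrt_le_left (by positivity)]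
    nlinarith
  have hb : c * x ^ (f.natDegree + 2) ≤ base f n m := by
    calc c * x ^ (f.natDegree + 2) = n * m * (c * x ^ f.natDegree) := by
          rw [pow_add, hx2]; ring
      _ ≤ n * m * (c * (m + n) ^ f.natDegree) := by gcongr
      _ = n * (m : ℝ) ^ (f.natDegree + 1) * (c * (1 + (n : ℝ) / m) ^ f.natDegree) := by
          rw [show (m : ℝ) + n = m * (1 + (n : ℝ) / m) by field_simp, mul_pow]
          ring
      _ ≤ base f n m := by
          rw [base]
          gcongr
          exact hle _ (by positivity)
  have hxpow : x ^ (f.natDegree + 2) = ((n : ℝ) * m) ^ (((f.natDegree : ℝ) + 2) / 2) := by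
    rw [← hx2, ← Real.rpow_natCast x 2, ← Real.rpow_mul hx0.le, ← Real.rpow_natCast]
    congr 1
    push_cast
    ring
  rw [term, Complex.norm_cpow_eq_rpow_re_of_pos (base_pos hpos n m), Complex.neg_re]
  calc base f n m ^ (-s.re) ≤ (c * x ^ (f.natDegree + 2)) ^ (-s.re) :=
        Real.rpow_le_rpow_of_nonpos (by positivity) hb (by linarith)
    _ = c ^ (-s.re) * ((n : ℝ) * m) ^ (-(((f.natDegree : ℝ) + 2) / 2 * s.re)) := by
        rw [Real.mul_rpow hc.le (by positivity), hxpow, ← Real.rpow_mul (by positivity)]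
        ring_nf
    _ = _ := by rw [Real.mul_rpow hn.le hm.le]

lemma summable_norm_term {s : ℂ} (hs : s ∈ halfPlane f) : Summable fun p => ‖term f s p‖ := by
  obtain ⟨c, hc, -, h⟩ := exists_norm_term_le hpos
  have h1 := one_lt_half_mul_of_abscissa_lt hs
  refine Summable.of_nonneg_of_le (fun p => norm_nonneg _)
    (fun p => h s p ((abscissa_pos f).trans hs).le) (Summable.mul_left _ ?_)
  exact (summable_pnat_rpow (by linarith)).mul_of_nonneg (summable_pnat_rpow (by linarith))
    (fun n => by positivity) (fun n => by positivity)

lemma differentiableOn_series : DifferentiableOn ℂ (series f) (halfPlane f) := by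
  intro s₀ hs₀
  obtain ⟨c, hc, hc1, h⟩ := exists_norm_term_le hpos
  obtain ⟨a, ha1, ha2⟩ := exists_between (show abscissa f < s₀.re from hs₀)
  have ha := one_lt_half_mul_of_abscissa_lt ha1
  -- As `c` may be less than `1`, the factor `c ^ (-Re s)` needs an upper bound on `Re s`.
  set R : Set ℂ := {s : ℂ | a < s.re ∧ s.re < s₀.re + 1} with hR
  have hRo : IsOpen R := (isOpen_lt continuous_const Complex.continuous_re).inter
    (isOpen_lt Complex.continuous_re continuous_const)
  have hsum : Summable fun p : ℕ+ × ℕ+ => c ^ (-(s₀.re + 1)) *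
        ((p.1 : ℝ) ^ (-(((f.natDegree : ℝ) + 2) / 2 * a)) *
          (p.2 : ℝ) ^ (-(((f.natDegree : ℝ) + 2) / 2 * a))) :=
    Summable.mul_left _ ((summable_pnat_rpow (by linarith)).mul_of_nonneg
      (summable_pnat_rpow (by linarith)) (fun n => by positivity) (fun n => by positivity))
  have hD := Complex.differentiableOn_tsum_of_summable_norm (F := fun p s => term f s p) hsum
    (fun p s _ => (differentiableAt_id.neg.const_cpow (Or.inl (Complex.ofReal_ne_zero.mpr
      (base_pos hpos p.1 p.2).ne'))).differentiableWithinAt) hRo (fun p s hs => ?_)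
  · exact (hD.differentiableAt (hRo.mem_nhds ⟨ha2, by linarith⟩)).differentiableWithinAt
  · have hs0 : 0 < s.re := (abscissa_pos f).trans (ha1.trans hs.1)
    refine (h s p hs0.le).trans ?_
    have hp1 : (1 : ℝ) ≤ p.1 := by exact_mod_cast one_le (a := p.1)
    have hp2 : (1 : ℝ) ≤ p.2 := by exact_mod_cast one_le (a := p.2)
    have hexp : -(((f.natDegree : ℝ) + 2) / 2 * s.re) ≤ -(((f.natDegree : ℝ) + 2) / 2 * a) :=
      neg_le_neg (mul_le_mul_of_nonneg_left hs.1.le (by positivity))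
    have e1 := Real.rpow_le_rpow_of_exponent_le hp1 hexp
    have e2 := Real.rpow_le_rpow_of_exponent_le hp2 hexp
    have e3 : c ^ (-s.re) ≤ c ^ (-(s₀.re + 1)) :=
      Real.rpow_le_rpow_of_exponent_ge hc hc1 (by linarith [hs.2])
    gcongr

lemma term_eq_cpow_mul_kernel (s : ℂ) (n m : ℕ+) :
    term f s (n, m) =
      ((m : ℝ) : ℂ) ^ (-((f.natDegree + 2 : ℕ) : ℂ) * s) * kernel f s ((n : ℝ) / m) := by
  have hm : (0 : ℝ) < m := by exact_mod_cast m.pos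
  have hp : 0 < profile f ((n : ℝ) / m) :=
    profile_pos hpos (div_pos (by exact_mod_cast n.pos) hm)
  rw [term, base_eq_profile, Complex.ofReal_mul,
    Complex.mul_cpow_ofReal_nonneg (by positivity) hp.le, kernel]
  congr 1
  rw [Complex.cpow_def_of_ne_zero (by exact_mod_cast (pow_pos hm _).ne'),
    Complex.cpow_def_of_ne_zero (by exact_mod_cast hm.ne'), ← Complex.ofReal_log (by positivity),
    ← Complex.ofReal_log hm.le, Real.log_pow]
  congr 1
  push_cast
  ring

end

/-! ### Continuation to the strip -/

/-- The expression that continues the double series to the strip: the cell integrals add up to a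
multiple of `ζ((d+2)s - 1)`, and the remaining sum of defects is holomorphic. -/
noncomputable def stripContinuation (f : ℝ[X]) (s : ℂ) : ℂ :=
  riemannZeta ((f.natDegree + 2 : ℕ) * s - 1) * (∫ t in Ioi 0, kernel f s t) + ∑' p, defect f s p

lemma tsum_pnat_cpow {w : ℂ} (hw : 1 < w.re) :
    ∑' m : ℕ+, ((m : ℝ) : ℂ) ^ (-w) = riemannZeta w := by
  rw [zeta_eq_tsum_one_div_nat_add_one_cpow hw,
    tsum_pnat_eq_tsum_succ (f := fun m : ℕ => ((m : ℝ) : ℂ) ^ (-w))]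
  simp [Complex.cpow_neg]

/-- The Riemann zeta function is meromorphic at every point. -/
lemma meromorphicAt_riemannZeta (w : ℂ) : MeromorphicAt riemannZeta w := by
  rcases eq_or_ne w 1 with rfl | hw
  -- The exponent is `2` rather than `1`: the product vanishes at `1` whatever the value of
  -- `riemannZeta 1`, and so it is continuous there.
  · refine ⟨2, Complex.analyticAt_of_differentiable_on_punctured_nhds_of_continuousAt ?_ ?_⟩
    · filter_upwards [self_mem_nhdsWithin] with z hz
      exact ((differentiableAt_id.sub_const 1).pow 2).smul (differentiableAt_riemannZeta hz)
    · rw [continuousAt_iff_punctured_nhds]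
      have h1 : Tendsto (fun z : ℂ => z - 1) (𝓝[≠] 1) (𝓝 0) := by
        have : Tendsto (fun z : ℂ => z - 1) (𝓝 1) (𝓝 (1 - 1)) :=
          tendsto_id.sub_const 1
        simpa using this.mono_left nhdsWithin_le_nhds
      have h2 := h1.mul riemannZeta_residue_one
      simp only [sub_self, smul_eq_mul, ne_eq, OfNat.ofNat_ne_zero, not_false_eq_true, zero_pow,
        zero_mul] at h2 ⊢
      exact h2.congr fun z => by ring
  · refine (DifferentiableOn.analyticAt (s := {1}ᶜ) (fun z hz => ?_)
      (isOpen_compl_singleton.mem_nhds hw)).meromorphicAt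
    exact (differentiableAt_riemannZeta hz).differentiableWithinAt

section

variable {f : ℝ[X]} (hpos : ∀ x : ℝ, 0 ≤ x → 0 < f.eval x)
include hpos

lemma series_eq_stripContinuation {s : ℂ} (hs : s ∈ strip f) (hs' : s ∈ halfPlane f) :
    series f s = stripContinuation f s := by
  set A : ℂ := ((f.natDegree + 2 : ℕ) : ℂ) with hA
  have hterm := (summable_norm_term hpos hs').of_norm
  have hdef := summable_defect hpos hs
  set G : ℕ+ × ℕ+ → ℂ := fun p =>
    ((p.2 : ℝ) : ℂ) ^ (-(A * s - 1)) * ∫ t in cell p.1 p.2, kernel f s t with hG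
  have hpow : ∀ m : ℕ+,
      ((m : ℝ) : ℂ) ^ (-A * s) * m = ((m : ℝ) : ℂ) ^ (-(A * s - 1)) := fun m => by
    have hm : ((m : ℝ) : ℂ) ≠ 0 := by exact_mod_cast m.ne_zero
    rw [show -(A * s - 1) = -A * s + 1 by ring, Complex.cpow_add _ _ hm, Complex.cpow_one]
    simp
  have hGeq : ∀ p, G p = term f s p - defect f s p := fun ⟨n, m⟩ => by
    simp only [hG]
    rw [term_eq_cpow_mul_kernel hpos, defect, riemannError, ← hA, ← hpow]
    ring
  have hGs : Summable G := (hterm.sub hdef).congr fun p => (hGeq p).symm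
  have hre : 1 < (A * s - 1).re := by
    have h := one_lt_half_mul_of_abscissa_lt hs'
    have : (A * s - 1).re = ((f.natDegree : ℝ) + 2) * s.re - 1 := by
      rw [hA, ← Complex.ofReal_natCast, Complex.sub_re, Complex.re_ofReal_mul]
      push_cast
      rfl
    rw [this]
    linarith
  -- Summing over `n` first, the cells fill `(0, ∞)`; the sum over `m` is then the zeta series.
  have hGsum : ∑' p, G p = riemannZeta (A * s - 1) * ∫ t in Ioi 0, kernel f s t := by
    rw [← (Equiv.prodComm ℕ+ ℕ+).tsum_eq G,
      Summable.tsum_prod (f := fun c => G (Equiv.prodComm ℕ+ ℕ+ c))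
        ((Equiv.prodComm ℕ+ ℕ+).summable_iff.mpr hGs), ← tsum_pnat_cpow hre, ← tsum_mul_right]
    refine tsum_congr fun m => ?_
    exact ((hasSum_integral_cell hpos hs m).mul_left (((m : ℝ) : ℂ) ^ (-(A * s - 1)))).tsum_eq
  rw [stripContinuation, ← hGsum, ← hGs.tsum_add hdef, series]
  exact tsum_congr fun p => by rw [hGeq]; ring

lemma meromorphicAt_stripContinuation {s : ℂ} (hs : s ∈ strip f) :
    MeromorphicAt (stripContinuation f) s := by
  have hnhds := (isOpen_strip f).mem_nhds hs
  have h1 : MeromorphicAt (fun s : ℂ => riemannZeta ((f.natDegree + 2 : ℕ) * s - 1)) s :=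
    (meromorphicAt_riemannZeta _).comp_analyticAt
      (g := fun s : ℂ => ((f.natDegree + 2 : ℕ) : ℂ) * s - 1) (by fun_prop)
  exact (h1.mul ((differentiableOn_integral_kernel hpos Subset.rfl
    measurableSet_Ioi).analyticAt hnhds).meromorphicAt).add
    ((differentiableOn_tsum_defect hpos).analyticAt hnhds).meromorphicAt

lemma tendsto_mul_stripContinuation (hd : 1 ≤ f.natDegree) :
    Tendsto (fun s : ℂ => (s - abscissa f) * stripContinuation f s) (𝓝[≠] (abscissa f : ℂ))
      (𝓝 (1 / ((f.natDegree + 2 : ℕ) : ℂ) * ∫ t in Ioi 0, kernel f (abscissa f) t)) := by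
  set A : ℂ := ((f.natDegree + 2 : ℕ) : ℂ) with hA
  set s₀ : ℂ := (abscissa f : ℂ) with hs₀
  have hA0 : A ≠ 0 := Nat.cast_ne_zero.mpr (Nat.succ_ne_zero _)
  have hAs : A * s₀ = 2 := by
    have h0 : (f.natDegree : ℂ) + 2 ≠ 0 := by
      exact_mod_cast (Nat.succ_ne_zero (f.natDegree + 1))
    rw [hA, hs₀, abscissa]
    push_cast
    field_simp
  have hnhds := (isOpen_strip f).mem_nhds (abscissa_mem_strip hd)
  have hw : Tendsto (fun s : ℂ => A * s - 1) (𝓝[≠] s₀) (𝓝[≠] 1) := by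
    refine tendsto_nhdsWithin_iff.mpr ⟨?_, ?_⟩
    · have : ContinuousAt (fun s : ℂ => A * s - 1) s₀ := by fun_prop
      have h := this.tendsto
      rw [hAs, show (2 : ℂ) - 1 = 1 by norm_num] at h
      exact h.mono_left nhdsWithin_le_nhds
    · filter_upwards [self_mem_nhdsWithin] with s hs h
      refine hs (mul_left_cancel₀ hA0 ?_)
      rw [hAs, ← sub_left_inj (a := (1 : ℂ)), mem_singleton_iff.mp h]
      norm_num
  have h1 := riemannZeta_residue_one.comp hw
  have h2 := (((differentiableOn_integral_kernel hpos Subset.rfl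
    measurableSet_Ioi).differentiableAt hnhds).continuousAt.tendsto).mono_left
    (nhdsWithin_le_nhds (s := {s₀}ᶜ))
  have h3 := (((differentiableOn_tsum_defect hpos).differentiableAt
    hnhds).continuousAt.tendsto).mono_left (nhdsWithin_le_nhds (s := {s₀}ᶜ))
  have h4 : Tendsto (fun s : ℂ => s - s₀) (𝓝[≠] s₀) (𝓝 0) := by
    have : Tendsto (fun s : ℂ => s - s₀) (𝓝 s₀) (𝓝 (s₀ - s₀)) := tendsto_id.sub_const s₀
    simpa using this.mono_left nhdsWithin_le_nhds
  have h5 := ((h1.const_mul (1 / A)).mul h2).add (h4.mul h3)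
  rw [zero_mul, add_zero, mul_one] at h5
  refine h5.congr fun s => ?_
  have h6 : A * s - 1 - 1 = A * (s - s₀) := by rw [mul_sub, hAs]; ring
  simp only [Function.comp_apply, stripContinuation, h6, ← hA]
  field_simp

/-- The continuation is the series on the half-plane and `stripContinuation` on the rest of
`Re s > 1/(d+1)`. -/
lemma isMeromorphicContinuation_piecewise (hd : 1 ≤ f.natDegree) :
    ∃ (U : Set ℂ) (Z : ℂ → ℂ), IsMeromorphicContinuation f U Z ∧ (abscissa f : ℂ) ∈ U := by
  classical
  have hd1 : (0 : ℝ) < (f.natDegree : ℝ) + 1 := by positivity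
  refine ⟨{s | 1 / ((f.natDegree : ℝ) + 1) < s.re},
    (halfPlane f).piecewise (series f) (stripContinuation f), ⟨?_, ?_, ?_, ?_, ?_⟩, ?_⟩
  · exact isOpen_lt continuous_const Complex.continuous_re
  · exact (convex_halfSpace_re_gt _).isPreconnected
  · intro s hs
    rw [mem_ofPred_eq, div_lt_iff₀ hd1, mul_comm]
    exact one_lt_mul_of_abscissa_le hd (le_of_lt hs)
  · intro s hs
    rw [mem_ofPred_eq, div_lt_iff₀ hd1, mul_comm] at hs
    by_cases h : s ∈ halfPlane f
    · have hn := (isOpen_halfPlane f).mem_nhds h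
      refine ((differentiableOn_series hpos).analyticAt hn).meromorphicAt.congr ?_
      filter_upwards [nhdsWithin_le_nhds hn] with z hz
      rw [piecewise_eq_of_mem _ _ _ hz]
    · have hst : s ∈ strip f := ⟨hs, (not_lt.mp h).trans_lt (abscissa_lt_one hd)⟩
      refine (meromorphicAt_stripContinuation hpos hst).congr ?_
      filter_upwards [nhdsWithin_le_nhds ((isOpen_strip f).mem_nhds hst)] with z hz
      by_cases hz' : z ∈ halfPlane f
      · rw [piecewise_eq_of_mem _ _ _ hz', series_eq_stripContinuation hpos hz hz']
      · rw [piecewise_eq_of_notMem _ _ _ hz']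
  · intro s hs
    rw [piecewise_eq_of_mem _ _ _ hs]
  · rw [mem_ofPred_eq, div_lt_iff₀ hd1, mul_comm]
    exact (abscissa_mem_strip hd).1

/-! ### The simple pole and its residue -/

/-- Both functions are meromorphic at the boundary point and agree at points of the half-plane
accumulating there, so they agree on a punctured neighbourhood. -/
lemma IsMeromorphicContinuation.eventuallyEq_stripContinuation (hd : 1 ≤ f.natDegree) {U : Set ℂ}
    {Z : ℂ → ℂ} (hZ : IsMeromorphicContinuation f U Z) (hU : (abscissa f : ℂ) ∈ U) :
    Z =ᶠ[𝓝[≠] (abscissa f : ℂ)] stripContinuation f := by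
  have hmem := abscissa_mem_strip hd
  refine ((hZ.meromorphicOn _ hU).frequently_eq_iff_eventuallyEq
    (meromorphicAt_stripContinuation hpos hmem)).mp ?_
  have hlim : Tendsto (fun x : ℝ => (x : ℂ)) (𝓝[>] (abscissa f)) (𝓝[≠] (abscissa f : ℂ)) := by
    refine tendsto_nhdsWithin_iff.mpr ⟨?_, ?_⟩
    · exact (Complex.continuous_ofReal.tendsto _).mono_left nhdsWithin_le_nhds
    · filter_upwards [self_mem_nhdsWithin] with x hx h
      exact (ne_of_gt hx) (Complex.ofReal_injective h)
  refine hlim.frequently (Eventually.frequently ?_)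
  have hstrip := hlim (nhdsWithin_le_nhds ((isOpen_strip f).mem_nhds hmem))
  filter_upwards [self_mem_nhdsWithin, hstrip] with x hx hxs
  have hxh : (x : ℂ) ∈ halfPlane f := hx
  rw [hZ.eqOn hxh, series_eq_stripContinuation hpos hxs hxh]

lemma integral_kernel_ofReal (σ : ℝ) :
    ∫ t in Ioi 0, kernel f σ t = ((∫ t in Ioi 0, profile f t ^ (-σ) : ℝ) : ℂ) := by
  refine Eq.trans ?_ integral_ofReal
  refine setIntegral_congr_fun measurableSet_Ioi fun t ht => ?_
  simp only [kernel, ← Complex.ofReal_neg]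
  exact (Complex.ofReal_cpow (profile_pos hpos ht).le _).symm

lemma integral_profile_rpow_pos {σ : ℝ} (h1 : 1 < ((f.natDegree : ℝ) + 1) * σ) (h2 : σ < 1) :
    0 < ∫ t in Ioi 0, profile f t ^ (-σ) := by
  have hp : ∀ t ∈ Ioi (0 : ℝ), 0 < profile f t ^ (-σ) := fun t ht =>
    Real.rpow_pos_of_pos (profile_pos hpos ht) _
  rw [setIntegral_pos_iff_support_of_nonneg_ae _ (integrableOn_profile_rpow hpos h1 h2)]
  · have hsupp : Ioi (0 : ℝ) ⊆ Function.support fun t => profile f t ^ (-σ) :=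
      fun t ht => (hp t ht).ne'
    rw [inter_eq_right.mpr hsupp]
    simp
  · filter_upwards [ae_restrict_mem measurableSet_Ioi] with t ht using (hp t ht).le

lemma F_eq_integral_kernel :
    F f (2 / ((f.natDegree : ℂ) + 2)) (f.natDegree / ((f.natDegree : ℂ) + 2)) =
      ∫ t in Ioi 0, kernel f (abscissa f) t := by
  have h0 : (f.natDegree : ℂ) + 2 ≠ 0 := by
    exact_mod_cast (Nat.succ_ne_zero (f.natDegree + 1))
  refine setIntegral_congr_fun measurableSet_Ioi fun t ht => ?_
  have hexp : (f.natDegree : ℂ) / ((f.natDegree : ℂ) + 2) - 1 = -(abscissa f : ℂ) := by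
    rw [abscissa]; push_cast; field_simp; ring
  have hexp' : 2 / ((f.natDegree : ℂ) + 2) = (abscissa f : ℂ) := by
    rw [abscissa]; push_cast; rfl
  simp only [hexp, hexp']
  rw [kernel, profile, Complex.ofReal_mul,
    Complex.mul_cpow_ofReal_nonneg (le_of_lt ht) (hpos t (le_of_lt ht)).le, mul_comm]

lemma IsMeromorphicContinuation.hasSimplePoleWithResidue (hd : 1 ≤ f.natDegree) {U : Set ℂ}
    {Z : ℂ → ℂ} (hZ : IsMeromorphicContinuation f U Z) (hU : (abscissa f : ℂ) ∈ U) :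
    HasSimplePoleWithResidue Z (abscissa f)
      (1 / ((f.natDegree + 2 : ℕ) : ℂ) * ∫ t in Ioi 0, kernel f (abscissa f) t) := by
  have hmer := hZ.meromorphicOn _ hU
  have hlim : Tendsto (fun s : ℂ => (s - abscissa f) * Z s) (𝓝[≠] (abscissa f : ℂ))
      (𝓝 (1 / ((f.natDegree + 2 : ℕ) : ℂ) * ∫ t in Ioi 0, kernel f (abscissa f) t)) := by
    refine (tendsto_mul_stripContinuation hpos hd).congr' ?_
    filter_upwards [hZ.eventuallyEq_stripContinuation hpos hd hU] with s hs
    rw [hs]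
  refine ⟨hmer, ?_, hlim⟩
  have hne : (1 / ((f.natDegree + 2 : ℕ) : ℂ) * ∫ t in Ioi 0, kernel f (abscissa f) t) ≠ 0 := by
    have hmem := abscissa_mem_strip hd
    refine mul_ne_zero (one_div_ne_zero (Nat.cast_ne_zero.mpr (by omega))) ?_
    rw [integral_kernel_ofReal hpos]
    exact Complex.ofReal_ne_zero.mpr (integral_profile_rpow_pos hpos
      (one_lt_mul_of_abscissa_le hd le_rfl) (abscissa_lt_one hd)).ne'
  have hlin : AnalyticAt ℂ (fun s : ℂ => s - abscissa f) (abscissa f) := by fun_prop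
  have hord : meromorphicOrderAt (fun s : ℂ => s - abscissa f) (abscissa f) = 1 := by
    refine (meromorphicOrderAt_eq_int_iff (n := 1) hlin.meromorphicAt).mpr
      ⟨fun _ => 1, analyticAt_const, one_ne_zero, Eventually.of_forall fun s => by simp⟩
  have hprod := (tendsto_ne_zero_iff_meromorphicOrderAt_eq_zero (hlin.meromorphicAt.mul hmer)).mp
    ⟨_, hne, hlim⟩
  rw [meromorphicOrderAt_mul hlin.meromorphicAt hmer, hord] at hprod
  generalize meromorphicOrderAt Z (abscissa f) = k at hprod ⊢
  induction k using WithTop.recTopCoe with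
  | top => simp at hprod
  | coe k =>
    norm_cast at hprod ⊢
    have : k = -1 := by omega
    rw [this]
    rfl

end

end WittenZeta

theorem mainTheorem4 (d : ℕ) (hd : 1 ≤ d) (f : Polynomial ℝ) (hdeg : f.natDegree = d)
    (hpos : ∀ x : ℝ, 0 ≤ x → 0 < f.eval x) :
    -- the series converges absolutely for Re s > 2/(d+2)
    (∀ s : ℂ, 2 / ((d : ℝ) + 2) < s.re → Summable (fun p => ‖WittenZeta.term f s p‖)) ∧
    -- it can be continued meromorphically past the point 2/(d+2)
    (∃ (U : Set ℂ) (Z : ℂ → ℂ), WittenZeta.IsMeromorphicContinuation f U Z ∧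
      (2 / ((d : ℂ) + 2)) ∈ U) ∧
    -- the continuation has a simple pole there, with the stated residue
    (∀ (U : Set ℂ) (Z : ℂ → ℂ), WittenZeta.IsMeromorphicContinuation f U Z →
      (2 / ((d : ℂ) + 2)) ∈ U →
      WittenZeta.HasSimplePoleWithResidue Z (2 / ((d : ℂ) + 2))
        (1 / ((d : ℂ) + 2) *
          WittenZeta.F f (2 / ((d : ℂ) + 2)) ((d : ℂ) / ((d : ℂ) + 2)))) ∧
    -- the residue as a convergent real integral
    MeasureTheory.IntegrableOn
      (fun x : ℝ => (x * f.eval x) ^ (-(2 / ((d : ℝ) + 2)))) (Set.Ioi 0) ∧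
    1 / ((d : ℂ) + 2) * WittenZeta.F f (2 / ((d : ℂ) + 2)) ((d : ℂ) / ((d : ℂ) + 2)) =
      ((1 / ((d : ℝ) + 2) *
        ∫ x in Set.Ioi (0 : ℝ), (x * f.eval x) ^ (-(2 / ((d : ℝ) + 2))) : ℝ) : ℂ) := by

  subst hdeg
  have habs : (2 : ℂ) / ((f.natDegree : ℂ) + 2) = (WittenZeta.abscissa f : ℂ) := by
    rw [WittenZeta.abscissa]; push_cast; rfl
  have hA : (f.natDegree : ℂ) + 2 = ((f.natDegree + 2 : ℕ) : ℂ) := by push_cast; rfl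
  have hF := WittenZeta.F_eq_integral_kernel hpos
  refine ⟨fun s hs => WittenZeta.summable_norm_term hpos hs, ?_, fun U Z hZ hU => ?_, ?_, ?_⟩
  · rw [habs]
    exact WittenZeta.isMeromorphicContinuation_piecewise hpos hd
  · rw [hF, habs, hA]
    rw [habs] at hU
    exact hZ.hasSimplePoleWithResidue hpos hd hU
  · exact WittenZeta.integrableOn_profile_rpow hpos
      (WittenZeta.one_lt_mul_of_abscissa_le hd le_rfl) (WittenZeta.abscissa_lt_one hd)
  · rw [hF, WittenZeta.integral_kernel_ofReal hpos]
    push_cast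
    rfl
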